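/- All spaces are Hausdorff, and a continuum is a nonempty metrizable, compact, connected space. For a compact space $K$ and a sequence $(f_n)_{n\in\mathbb N}$ of continuous functions $K\to[0,1]$ that is pairwise disjoint ($f_m f_n=0$ for $m\neq n$), let $\operatorname{supp}(f_n)=\overline{\{x: f_n(x)\neq 0\}}$ and let $D((f_n)_n)$ be the union of all open sets $U\subseteq K$ such that $\{n : U\cap \operatorname{supp}(f_n)\neq\emptyset\}$ is finite. The extension $K((f_n)_n)$ of $K$ by $(f_n)_n$ is the closure in $K\times[0,1]$ of the graph of the restriction of $\sum_{n} f_n$ to $D((f_n)_n)$. A space $L\subseteq K\times[0,1]$ is an extension of $K$ by continuous functions if $L=K((f_n)_n)$ for some such pairwise disjoint sequence. Theorem. (1) Let $K_0$ be a continuum with more than one point. There exist compact spaces $K_1,K_2,K_3$ such that $K_i$ is an extension of $K_{i-1}$ by continuous functions for $i=1,2,3$, and $K_3$ is disconnected. (2) Consequently, if $\mathcal C$ is a class of continua containing at least one continuum with more than one point, then $\mathcal C$ is not closed under extensions by continuous functions: it is not the case that, whenever $K\in\mathcal C$ and $L$ is an extension of $K$ by continuous functions, $L\in\mathcal C$.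 -/

import Mathlib

open scoped unitInterval

universe u

/-- A (metrizable) continuum: a metrizable, compact, connected (in particular nonempty) space. -/
structure IsContinuum (K : Type u) [TopologicalSpace K] : Prop where
  metrizable : TopologicalSpace.MetrizableSpace K
  compact : CompactSpace K
  connected : ConnectedSpace K

/-- A sequence of continuous functions `K → [0,1]` is pairwise disjoint if `f m * f n = 0`
whenever `m ≠ n`. -/
def PairwiseDisjointSeq {K : Type u} [TopologicalSpace K] (f : ℕ → C(K, I)) : Prop :=
  ∀ m n : ℕ, m ≠ n → ∀ x : K, f m x * f n x = 0

/-- `D((f n))`: the union of all open sets `U` that meet the closed support of `f n` for only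
finitely many `n`. -/
def finiteMeetingSet {K : Type u} [TopologicalSpace K] (f : ℕ → C(K, I)) : Set K :=
  ⋃₀ {U : Set K | IsOpen U ∧ {n : ℕ | (U ∩ tsupport (f n)).Nonempty}.Finite}

/-- `K((f n))`: the closure in `K × [0,1]` of the graph of the pointwise sum `∑ f n` restricted
to `D((f n))`. (For a pairwise disjoint sequence at most one term of the sum is nonzero at each
point, so the sum converges and lies in `[0,1]`.) -/
def extensionBy {K : Type u} [TopologicalSpace K] (f : ℕ → C(K, I)) : Set (K × I) :=
  closure {p : K × I | p.1 ∈ finiteMeetingSet f ∧ (p.2 : ℝ) = ∑' n : ℕ, (f n p.1 : ℝ)}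

/-- `L ⊆ K × [0,1]` is an extension of `K` by continuous functions. -/
def IsExtension {K : Type u} [TopologicalSpace K] (L : Set (K × I)) : Prop :=
  ∃ f : ℕ → C(K, I), PairwiseDisjointSeq f ∧ L = extensionBy f

/-! Choose a continuous `g ≤ 1` on `K₀` taking both signs. Tents in the variable `1 / g` sum to 1
where `g > 0` and to 0 where `g ≤ 0`; consecutive tents overlap, but those of one parity are
pairwise disjoint. Extend by the odd tents, then by the pulled-back even ones. The two new
coordinates add up to 0 or 1 on a dense set, hence everywhere, and both values occur: two extensions
already disconnect (`not_isPreconnected_extensionBy_tentSeq`). Any third extension projects onto the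
second, so it is disconnected too. -/

open Topology

section Extension

variable {K : Type u} [TopologicalSpace K]

/-- The pointwise sum of a sequence of continuous functions into the unit interval. -/
noncomputable def seqSum (f : ℕ → C(K, I)) (x : K) : ℝ := ∑' n : ℕ, (f n x : ℝ)

theorem mem_finiteMeetingSet_of_forall_le {f : ℕ → C(K, I)} {x : K} {U : Set K} (hU : IsOpen U)
    (hx : x ∈ U) (N : ℕ) (h : ∀ n, ∀ y ∈ U, f n y ≠ 0 → n ≤ N) : x ∈ finiteMeetingSet f := by
  refine ⟨U, ⟨hU, (Set.finite_Iic N).subset ?_⟩, hx⟩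
  rintro n ⟨y, hyU, hy⟩
  obtain ⟨z, hzU, hz⟩ := mem_closure_iff.1 hy U hU hyU
  exact h n z hzU hz

theorem continuousAt_seqSum {f : ℕ → C(K, I)} {x : K} (hx : x ∈ finiteMeetingSet f) :
    ContinuousAt (seqSum f) x := by
  obtain ⟨U, ⟨hU, hfin⟩, hxU⟩ := hx
  have hc : ContinuousAt (fun y => ∑ n ∈ hfin.toFinset, (f n y : ℝ)) x := by fun_prop
  refine hc.congr ?_
  filter_upwards [hU.mem_nhds hxU] with y hy
  refine (tsum_eq_sum fun n hn => ?_).symm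
  by_contra hne
  refine hn (hfin.mem_toFinset.2 ⟨y, hy, subset_tsupport _ ?_⟩)
  intro h
  exact hne (by simp [h])

/-- The finite meeting set of a pairwise disjoint sequence is dense. -/
theorem dense_finiteMeetingSet {f : ℕ → C(K, I)} (hf : PairwiseDisjointSeq f) :
    Dense (finiteMeetingSet f) := by
  intro x
  by_contra hx
  have hO : IsOpen (closure (finiteMeetingSet f))ᶜ := isClosed_closure.isOpen_compl
  -- Where some `f n` is nonzero, all the others vanish nearby, so the point lies in the finite
  -- meeting set. Hence every `f n` vanishes on the open complement of the closure, which puts `x`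
  -- itself in that set.
  refine hx (subset_closure (mem_finiteMeetingSet_of_forall_le hO hx 0 fun n y hy hn => ?_))
  refine absurd (subset_closure ?_) hy
  refine mem_finiteMeetingSet_of_forall_le (U := {z | f n z ≠ 0})
    (isOpen_ne_fun (f n).continuous continuous_const) hn n fun m z hz hm => ?_
  by_contra hmn
  exact mul_ne_zero hm hz (hf m n (by omega) z)

theorem seqSum_mem_unitInterval {f : ℕ → C(K, I)} (hf : PairwiseDisjointSeq f) (x : K) :
    seqSum f x ∈ I := by
  by_cases h : ∃ n, f n x ≠ 0
  · obtain ⟨n, hn⟩ := h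
    have : seqSum f x = f n x := by
      refine tsum_eq_single n fun m hm => ?_
      have := (mul_eq_zero.1 (hf m n hm x)).resolve_right hn
      simp [this]
    rw [this]
    exact (f n x).2
  · push Not at h
    simp [seqSum, h]

theorem mk_mem_extensionBy {f : ℕ → C(K, I)} (hf : PairwiseDisjointSeq f) {x : K}
    (hx : x ∈ finiteMeetingSet f) :
    (x, (⟨seqSum f x, seqSum_mem_unitInterval hf x⟩ : I)) ∈ extensionBy f :=
  subset_closure ⟨hx, rfl⟩

/-- An extension of a compact Hausdorff space projects onto the space. -/
theorem image_fst_extensionBy [CompactSpace K] [T2Space K] {f : ℕ → C(K, I)}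
    (hf : PairwiseDisjointSeq f) : Prod.fst '' extensionBy f = Set.univ := by
  have hcl : IsClosed (Prod.fst '' extensionBy f) :=
    (isClosed_closure.isCompact.image continuous_fst).isClosed
  refine Set.univ_subset_iff.1 ?_
  rw [← (dense_finiteMeetingSet hf).closure_eq]
  exact hcl.closure_subset_iff.2 fun x hx => ⟨_, mk_mem_extensionBy hf hx, rfl⟩

/-- Extensions of a disconnected compact Hausdorff space are disconnected. -/
theorem not_isPreconnected_extensionBy [CompactSpace K] [T2Space K] {f : ℕ → C(K, I)}
    (hf : PairwiseDisjointSeq f) (hK : ¬ PreconnectedSpace K) :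
    ¬ IsPreconnected (extensionBy f) := fun h =>
  hK ⟨image_fst_extensionBy hf ▸ h.image _ continuous_fst.continuousOn⟩

end Extension

/-! ### Tents in the variable `1 / t` -/

section Tent

/-- As a function of `1 / t`, the piecewise linear bump of height one centred at `m + 1` and
supported in `[m, m + 2]`. -/
noncomputable def tentFun (m : ℕ) (t : ℝ) : I :=
  Set.projIcc 0 1 zero_le_one (1 - |t⁻¹ - (m + 1)|)

theorem coe_tentFun (m : ℕ) (t : ℝ) : (tentFun m t : ℝ) = max 0 (1 - |t⁻¹ - (m + 1)|) := by
  rw [tentFun, Set.coe_projIcc, min_eq_right]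
  linarith [abs_nonneg (t⁻¹ - (m + 1))]

theorem tentFun_ne_zero_iff {m : ℕ} {t : ℝ} :
    tentFun m t ≠ 0 ↔ m < t⁻¹ ∧ t⁻¹ < m + 2 := by
  rw [← unitInterval.coe_ne_zero, coe_tentFun, ne_comm, ← (le_max_left _ _).lt_iff_ne]
  simp only [lt_max_iff, lt_irrefl, false_or, sub_pos, abs_lt]
  constructor <;> rintro ⟨h1, h2⟩ <;> constructor <;> linarith

/-- Inversion is discontinuous only at 0, and the tent vanishes for `t < 1 / (m + 2)`. -/
theorem continuous_tentFun (m : ℕ) : Continuous (tentFun m) := by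
  refine continuous_iff_continuousAt.2 fun t => ?_
  by_cases ht : t = 0
  · subst ht
    have h : tentFun m =ᶠ[𝓝 0] fun _ => 0 := by
      filter_upwards [Iio_mem_nhds (show (0 : ℝ) < ((m : ℝ) + 2)⁻¹ by positivity)] with t ht
      by_contra h
      obtain ⟨h1, h2⟩ := tentFun_ne_zero_iff.1 h
      have hpos : 0 < t⁻¹ := lt_of_le_of_lt m.cast_nonneg h1
      exact lt_asymm ht (inv_lt_of_inv_lt₀ (inv_pos.1 hpos) h2)
    exact continuousAt_const.congr h.symm
  · unfold tentFun
    exact continuous_projIcc.continuousAt.comp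
      (continuousAt_const.sub ((continuousAt_inv₀ ht).sub continuousAt_const).abs)

/-- The function `tentFun m` as a bundled continuous map. -/
noncomputable def tent (m : ℕ) : C(ℝ, I) := ⟨tentFun m, continuous_tentFun m⟩

theorem tent_ne_zero_iff {m : ℕ} {t : ℝ} : tent m t ≠ 0 ↔ m < t⁻¹ ∧ t⁻¹ < m + 2 :=
  tentFun_ne_zero_iff

theorem tent_eq_zero_of_nonpos (m : ℕ) {t : ℝ} (ht : t ≤ 0) : tent m t = 0 := by
  by_contra h
  have := (tent_ne_zero_iff.1 h).1
  linarith [inv_nonpos.2 ht, m.cast_nonneg (α := ℝ)]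

theorem hasSum_tent {t : ℝ} (h0 : 0 < t) (h1 : t ≤ 1) :
    HasSum (fun m => (tent m t : ℝ)) 1 := by
  have hw : 1 ≤ t⁻¹ := (one_le_inv₀ h0).2 h1
  -- With `k + 1` the floor of `t⁻¹`, only tents `k` and `k + 1` can be nonzero at `t`. The bound `t
  -- ≤ 1` gives `t⁻¹ ≥ 1`, past the rising half of tent 0, where the sum would be below 1.
  obtain ⟨k, hk⟩ := Nat.exists_eq_add_of_le' ((Nat.one_le_floor_iff _).2 hw)
  have hle : ((k : ℝ) + 1) ≤ t⁻¹ := by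
    have := Nat.floor_le (zero_le_one.trans hw)
    rw [hk] at this
    exact_mod_cast this
  have hlt : t⁻¹ < (k : ℝ) + 2 := by
    have := Nat.lt_floor_add_one t⁻¹
    rw [hk] at this
    push_cast at this
    linarith
  have hs : ∑ m ∈ {k, k + 1}, (tent m t : ℝ) = 1 := by
    rw [Finset.sum_pair (by omega)]
    change (tentFun k t : ℝ) + (tentFun (k + 1) t : ℝ) = 1
    rw [coe_tentFun, coe_tentFun, abs_of_nonneg (by linarith),
      abs_of_nonpos (by push_cast; linarith), max_eq_right (by linarith),
      max_eq_right (by push_cast; linarith)]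
    push_cast
    ring
  rw [← hs]
  refine hasSum_sum_of_ne_finset_zero fun m hm => ?_
  by_contra hne
  have h : tent m t ≠ 0 := fun h => hne (by simp [h])
  obtain ⟨h2, h3⟩ := tent_ne_zero_iff.1 h
  have h4 : m < k + 2 := by exact_mod_cast h2.trans hlt
  have h5 : k + 1 < m + 2 := by exact_mod_cast hle.trans_lt h3
  simp only [Finset.mem_insert, Finset.mem_singleton] at hm
  omega

theorem tsum_tent_even_add_odd {t : ℝ} (h0 : 0 < t) (h1 : t ≤ 1) :
    (∑' n, (tent (2 * n) t : ℝ)) + ∑' n, (tent (2 * n + 1) t : ℝ) = 1 := by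
  have h := hasSum_tent h0 h1
  have he : Summable fun n => (tent (2 * n) t : ℝ) :=
    h.summable.comp_injective (i := fun n => 2 * n) fun a b hab => by simpa using hab
  have ho : Summable fun n => (tent (2 * n + 1) t : ℝ) :=
    h.summable.comp_injective (i := fun n => 2 * n + 1) fun a b hab => by simpa using hab
  rw [← h.tsum_eq]
  exact tsum_even_add_odd (f := fun m => (tent m t : ℝ)) he ho

end Tent

/-! ### Two extensions that disconnect -/

section TentSeq

variable {K : Type u} [TopologicalSpace K]

/-- The sequence of every second tent, starting with the one of index `r`, pulled back along a
continuous function. -/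
noncomputable def tentSeq (r : ℕ) (g : C(K, ℝ)) (n : ℕ) : C(K, I) := (tent (2 * n + r)).comp g

theorem pairwiseDisjointSeq_tentSeq (r : ℕ) (g : C(K, ℝ)) :
    PairwiseDisjointSeq (tentSeq r g) := by
  intro m n hmn x
  by_contra h
  obtain ⟨h1, h2⟩ := tent_ne_zero_iff.1 (left_ne_zero_of_mul h)
  obtain ⟨h3, h4⟩ := tent_ne_zero_iff.1 (right_ne_zero_of_mul h)
  have h5 : 2 * m + r < 2 * n + r + 2 := by exact_mod_cast h1.trans h4
  have h6 : 2 * n + r < 2 * m + r + 2 := by exact_mod_cast h3.trans h2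
  omega

theorem mem_finiteMeetingSet_tentSeq (r : ℕ) {g : C(K, ℝ)} {x : K} (hx : g x ≠ 0) :
    x ∈ finiteMeetingSet (tentSeq r g) := by
  rcases hx.lt_or_gt with hx | hx
  · refine mem_finiteMeetingSet_of_forall_le (U := {y | g y < 0})
      (isOpen_lt g.continuous continuous_const) hx 0 fun n y hy hn => ?_
    exact absurd (tent_eq_zero_of_nonpos _ (le_of_lt hy)) hn
  -- Near `x` the value of `1 / g` stays below `2 / g x`, which bounds the indices of the active
  -- tents.
  · obtain ⟨N, hN⟩ := exists_nat_gt (g x / 2)⁻¹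
    refine mem_finiteMeetingSet_of_forall_le (U := {y | g x / 2 < g y})
      (isOpen_lt continuous_const g.continuous) (half_lt_self hx) N fun n y hy hn => ?_
    have h1 := (tent_ne_zero_iff.1 hn).1
    have h2 : (g y)⁻¹ < (g x / 2)⁻¹ := inv_strictAnti₀ (half_pos hx) hy
    have h3 : 2 * n + r < N := by exact_mod_cast h1.trans (h2.trans hN)
    omega

theorem seqSum_tentSeq_of_nonpos (r : ℕ) {g : C(K, ℝ)} {x : K} (hx : g x ≤ 0) :
    seqSum (tentSeq r g) x = 0 := by
  simp [seqSum, tentSeq, tent_eq_zero_of_nonpos _ hx]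

theorem seqSum_tentSeq_add {g : C(K, ℝ)} {x : K} (h0 : 0 < g x) (h1 : g x ≤ 1) :
    seqSum (tentSeq 1 g) x + seqSum (tentSeq 0 g) x = 1 := by
  rw [add_comm]
  exact tsum_tent_even_add_odd h0 h1

/-- The pullback of a continuous function to a subspace of the product with the unit interval. -/
def pullbackFst (g : C(K, ℝ)) (L : Set (K × I)) : C(L, ℝ) :=
  ⟨fun p => g p.1.1, by fun_prop⟩

/-- Extending first by the odd tents and then by the even tents gives a disconnected space:
the sum of the two new coordinates takes the values `0` and `1` only, and both of them. -/
theorem not_isPreconnected_extensionBy_tentSeq {g : C(K, ℝ)} (hg : ∀ x, g x ≤ 1) {a b : K}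
    (ha : g a < 0) (hb : 0 < g b) :
    ¬ IsPreconnected
      (extensionBy (tentSeq 0 (pullbackFst g (extensionBy (tentSeq 1 g))))) := by
  set L := extensionBy (tentSeq 1 g)
  set G := pullbackFst g L
  have hsum : ∀ x, seqSum (tentSeq 1 g) x + seqSum (tentSeq 0 g) x ∈ ({0, 1} : Set ℝ) := by
    intro x
    rcases le_or_gt (g x) 0 with h | h
    · simp [seqSum_tentSeq_of_nonpos _ h]
    · simp [seqSum_tentSeq_add h (hg x)]
  have hclosed : IsClosed ({0, 1} : Set ℝ) := (Set.toFinite _).isClosed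
  let φ : L × I → ℝ := fun q => (q.1.1.2 : ℝ) + q.2
  have hφ : Continuous φ := by fun_prop
  have hgraph : ∀ p ∈ finiteMeetingSet (tentSeq 0 G),
      (p.1.2 : ℝ) + seqSum (tentSeq 0 G) p ∈ ({0, 1} : Set ℝ) := by
    intro p hp
    -- The finite meeting set may contain points with `G p = 0` off the first graph. There the sum
    -- is continuous and `p` is a limit of graph points, where `hsum` applies.
    by_contra hne
    have hc : ContinuousAt (fun q : L => (q.1.2 : ℝ) + seqSum (tentSeq 0 G) q) p :=
      ContinuousAt.add (by fun_prop) (continuousAt_seqSum hp)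
    have hev := hc.eventually (hclosed.isOpen_compl.mem_nhds hne)
    obtain ⟨O, hO, hsub⟩ := mem_nhds_subtype L p _ |>.1 hev
    obtain ⟨q, hqO, hq⟩ := mem_closure_iff_nhds.1 p.2 O hO
    have hqL : q ∈ L := subset_closure hq
    refine hsub (show (⟨q, hqL⟩ : L) ∈ Subtype.val ⁻¹' O from hqO) ?_
    have h2 : (q.2 : ℝ) = seqSum (tentSeq 1 g) q.1 := hq.2
    have := hsum q.1
    rwa [← h2] at this
  have himage : ∀ q ∈ extensionBy (tentSeq 0 G), φ q ∈ ({0, 1} : Set ℝ) := by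
    intro q hq
    refine closure_minimal ?_ (hclosed.preimage hφ) hq
    rintro ⟨p, v⟩ ⟨hp, hv⟩
    have := hgraph p hp
    rwa [← show (v : ℝ) = seqSum (tentSeq 0 G) p from hv] at this
  have hattain : ∀ x, g x ≠ 0 → seqSum (tentSeq 1 g) x + seqSum (tentSeq 0 g) x ∈
      φ '' extensionBy (tentSeq 0 G) := by
    intro x hx
    let p : L := ⟨_, mk_mem_extensionBy (pairwiseDisjointSeq_tentSeq 1 g)
      (mem_finiteMeetingSet_tentSeq 1 hx)⟩
    exact ⟨_, mk_mem_extensionBy (pairwiseDisjointSeq_tentSeq 0 G)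
      (mem_finiteMeetingSet_tentSeq 0 (x := p) hx), rfl⟩
  intro h
  have hconn := (h.image φ hφ.continuousOn).ordConnected
  have h0 := hattain a ha.ne
  have h1 := hattain b hb.ne'
  rw [seqSum_tentSeq_of_nonpos _ ha.le, seqSum_tentSeq_of_nonpos _ ha.le, add_zero] at h0
  rw [seqSum_tentSeq_add hb (hg b)] at h1
  obtain ⟨q, hq, hq2⟩ := hconn.out h0 h1 (show (1 / 2 : ℝ) ∈ Set.Icc 0 1 by norm_num)
  have := himage q hq
  rw [hq2] at this
  norm_num at this

end TentSeq

/-- Distance to `a`, lowered by half of `dist b a` and capped at 1. -/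
theorem exists_continuousMap_neg_pos (K : Type u) [TopologicalSpace K]
    [TopologicalSpace.MetrizableSpace K] [Nontrivial K] :
    ∃ (g : C(K, ℝ)) (a b : K), (∀ x, g x ≤ 1) ∧ g a < 0 ∧ 0 < g b := by
  let := TopologicalSpace.metrizableSpaceMetric K
  obtain ⟨a, b, hab⟩ := exists_pair_ne K
  have hd : 0 < dist b a := dist_pos.2 hab.symm
  refine ⟨⟨fun x => min 1 (dist x a - dist b a / 2), by fun_prop⟩, a, b,
    fun x => min_le_left _ _, ?_, ?_⟩
  · exact (min_le_right _ _).trans_lt (by simpa using hd)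
  · exact lt_min one_pos (by linarith)

theorem exists_three_extensions_not_isPreconnected (K₀ : Type u) [TopologicalSpace K₀]
    (hK : IsContinuum K₀) (hn : Nontrivial K₀) :
    ∃ (K₁ : Set (K₀ × I)) (K₂ : Set (K₁ × I)) (K₃ : Set (K₂ × I)),
      IsCompact K₁ ∧ IsCompact K₂ ∧ IsCompact K₃ ∧
      IsExtension K₁ ∧ IsExtension K₂ ∧ IsExtension K₃ ∧
      ¬ IsPreconnected K₃ := by
  have := hK.metrizable
  have := hK.compact
  obtain ⟨g, a, b, hg, ha, hb⟩ := exists_continuousMap_neg_pos K₀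
  let K₁ := extensionBy (tentSeq 1 g)
  have h₁ : IsCompact K₁ := isClosed_closure.isCompact
  have : CompactSpace K₁ := isCompact_iff_compactSpace.1 h₁
  let g₁ := pullbackFst g K₁
  let K₂ := extensionBy (tentSeq 0 g₁)
  have h₂ : IsCompact K₂ := isClosed_closure.isCompact
  have : CompactSpace K₂ := isCompact_iff_compactSpace.1 h₂
  let g₂ := pullbackFst g₁ K₂
  -- `K₂` is already disconnected; any pairwise disjoint sequence would serve for the third step.
  refine ⟨K₁, K₂, extensionBy (tentSeq 1 g₂), h₁, h₂, isClosed_closure.isCompact,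
    ⟨_, pairwiseDisjointSeq_tentSeq _ _, rfl⟩, ⟨_, pairwiseDisjointSeq_tentSeq _ _, rfl⟩,
    ⟨_, pairwiseDisjointSeq_tentSeq _ _, rfl⟩,
    not_isPreconnected_extensionBy (pairwiseDisjointSeq_tentSeq _ _) ?_⟩
  rw [← isPreconnected_iff_preconnectedSpace]
  exact not_isPreconnected_extensionBy_tentSeq hg ha hb

theorem mainTheorem4 :
    (∀ (K₀ : Type u) [TopologicalSpace K₀], IsContinuum K₀ → Nontrivial K₀ →
      ∃ (K₁ : Set (K₀ × I)) (K₂ : Set (K₁ × I)) (K₃ : Set (K₂ × I)),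
        IsCompact K₁ ∧ IsCompact K₂ ∧ IsCompact K₃ ∧
        IsExtension K₁ ∧ IsExtension K₂ ∧ IsExtension K₃ ∧
        ¬ IsPreconnected K₃) ∧
    (∀ C : (∀ (K : Type u) [TopologicalSpace K], Prop),
      (∀ (K : Type u) [TopologicalSpace K], C K → IsContinuum K) →
      (∃ (K : Type u) (_ : TopologicalSpace K), C K ∧ Nontrivial K) →
      ¬ (∀ (K : Type u) [TopologicalSpace K], C K →
          ∀ L : Set (K × I), IsExtension L → C L)) := by
  refine ⟨exists_three_extensions_not_isPreconnected, fun C hC hne hext => ?_⟩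
  obtain ⟨K₀, _, hK₀, hn⟩ := hne
  obtain ⟨K₁, K₂, K₃, -, -, -, h₁, h₂, h₃, h⟩ :=
    exists_three_extensions_not_isPreconnected K₀ (hC K₀ hK₀) hn
  have hK₃ : C K₃ := hext K₂ (hext K₁ (hext K₀ hK₀ K₁ h₁) K₂ h₂) K₃ h₃
  have := (hC K₃ hK₃).connected
  exact h (isPreconnected_iff_preconnectedSpace.2 inferInstance)
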